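/- **Model.** Let $\ell,T\ge 1$ be integers and $P>0$. At each time $t=\tau T$, $\tau\in\mathbb{Z}_{\ge 0}$, a source generates a packet consisting of the $\ell$ bits $b_{\tau\ell},\dots,b_{(\tau+1)\ell-1}$; all bits $b_0,b_1,\dots$ are i.i.d. uniform. The average rate of the source is $R=\frac{\ell}{T}\log 2$ (nats per time step). The network is an infinite cascade of channels $r=0,1,2,\dots$, with outputs $Y_r(t)=X_r(t)+Z_r(t)$, $t\in\mathbb{Z}_{\ge 0}$, where the noises $Z_r(t)$ ($r,t\ge 0$) are i.i.d. with zero mean and unit variance, of arbitrary (not necessarily Gaussian) distribution, and independent of the bits. All channel inputs satisfy $E[X_r(t)^2]\le P$. A *scheme* is a collection of (measurable) maps of all nodes at all times: node $0$ produces $X_0(t)$ from all packets generated up to time $t$ and from the feedback $Y_0(0),\dots,Y_0(t-1)$; node $r\ge1$ produces $X_r(t)$ from its measurements $Y_{r-1}(0),\dots,Y_{r-1}(t)$ in the case of *instantaneous hops*, or only from $Y_{r-1}(0),\dots,Y_{r-1}(t-1)$ in the case of *delayed hops*, and from the feedback $Y_r(0),\dots,Y_r(t-1)$; and node $r\ge1$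 also produces, at each time $t$, an estimate $\hat b_r(n|t)$ of each bit $b_n$ from $Y_{r-1}(0),\dots,Y_{r-1}(t)$ and $Y_r(0),\dots,Y_r(t-1)$. For $r\ge 1$ and a delay $\Delta\ge0$ put $$P_e(r,\Delta)=\sup_{\tau\in\mathbb{Z}_{\ge0}}\ \max_{\tau\ell\le n\le(\tau+1)\ell-1}\Pr\big(\hat b_r(n\,|\,\tau T+\Delta)\ne b_n\big).$$ A velocity $v>0$ is *achievable* if there is a scheme with $\lim_{r\to\infty}P_e(r,\lfloor r/v\rfloor)=0$. The *streaming information velocity* $V(R)\in[0,\infty]$ of the source is the supremum of all achievable velocities. **Theorem.** Let $C=\frac12\log(1+P)$ and $\eta=\big(1-\frac{P}{1+P}\big)e^{2R}=e^{-2(C-R)}$, and suppose that $R<C$. Then, for instantaneous hops, $$V(R)\ \ge\ e^{2(C-R)}-1=\frac{1-\eta}{\eta},$$ and, for delayed hops, $$V(R)\ \ge\ 1-e^{-2(C-R)}=1-\eta .$$ In particular, in both cases, a positive velocity is achievable for every rate $R<C$. -/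

import Mathlib

namespace CascadeIV

open MeasureTheory ProbabilityTheory Filter Topology

/-- Instantaneous hops: the channel input of a relay at time `t` may use its measurements up to and
including time `t`.  Delayed hops: only its measurements up to time `t - 1`. -/
inductive Hops where
  | instantaneous
  | delayed

/-- Number of measurements (those at times `0, 1, …`) that a relay may use for its channel input
at time `t`. -/
def Hops.avail : Hops → ℕ → ℕ
  | .instantaneous, t => t + 1
  | .delayed, t => t

/-- The average rate, in nats per time step, of a source that generates a packet of `ℓ` bits every
`T` time steps. -/
noncomputable def avgRate (ℓ T : ℕ) : ℝ := (ℓ : ℝ) / (T : ℝ) * Real.log 2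

/-- `C = ½ log (1 + P)`. -/
noncomputable def capacity (P : ℝ) : ℝ := 1 / 2 * Real.log (1 + P)

/-- `η = (1 - P̄) exp (2R)`, where `P̄ = P / (1 + P)`. -/
noncomputable def eta (P R : ℝ) : ℝ := (1 - P / (1 + P)) * Real.exp (2 * R)

/-- The randomness of the model.  The message bits `b i` are i.i.d. uniform; the noises `Z r t`
(`r` is the channel, `t` the time) are i.i.d. with zero mean and unit variance, of otherwise
arbitrary law; and the noises are independent of the bits. -/
structure IsModel {Ω : Type*} [MeasurableSpace Ω] (μ : Measure Ω)
    (b : ℕ → Ω → Bool) (Z : ℕ → ℕ → Ω → ℝ) : Prop where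
  measurable_bit : ∀ i, Measurable (b i)
  measurable_noise : ∀ r t, Measurable (Z r t)
  bit_uniform : ∀ i, μ {ω | b i ω = true} = 1 / 2
  bit_indep : iIndepFun b μ
  noise_indep : iIndepFun (fun p : ℕ × ℕ => Z p.1 p.2) μ
  noise_ident : ∀ r t, IdentDistrib (Z r t) (Z 0 0) μ μ
  noise_memLp : ∀ r t, MemLp (Z r t) 2 μ
  noise_mean : ∀ r t, ∫ ω, Z r t ω ∂μ = 0
  noise_variance : ∀ r t, variance (Z r t) μ = 1
  bit_noise_indep :
    IndepFun (fun ω (i : ℕ) => b i ω) (fun ω (p : ℕ × ℕ) => Z p.1 p.2 ω) μ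

/-- A scheme over the infinite cascade: the maps of all nodes at all times.

* `source t` gives the input of channel `0` at time `t` from the bits of packets `0, …, ⌊t / T⌋`
  and the past outputs `Y₀(0), …, Y₀(t - 1)` (feedback).
* `relay r t` belongs to node `r + 1`, and gives the input of channel `r + 1` at time `t` from the
  outputs of channel `r` that are available to the node, and from the past outputs
  `Y_{r+1}(0), …, Y_{r+1}(t - 1)` (feedback).
* `decoder r n t` belongs to node `r + 1`, and gives its estimate of bit `n` at time `t` from
  `Y_r(0), …, Y_r(t)` and `Y_{r+1}(0), …, Y_{r+1}(t - 1)`. -/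
structure Scheme (ℓ T : ℕ) (h : Hops) where
  source : (t : ℕ) → (Fin ((t / T + 1) * ℓ) → Bool) × (Fin t → ℝ) → ℝ
  relay : (r t : ℕ) → (Fin (h.avail t) → ℝ) × (Fin t → ℝ) → ℝ
  decoder : (r n t : ℕ) → (Fin (t + 1) → ℝ) × (Fin t → ℝ) → Bool
  measurable_source : ∀ t, Measurable (source t)
  measurable_relay : ∀ r t, Measurable (relay r t)
  measurable_decoder : ∀ r n t, Measurable (decoder r n t)

namespace Scheme

variable {ℓ T : ℕ} {h : Hops}

/-- The input of channel `r` at time `t`, when the message bits are `b` and the noises are `z`;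
the output of channel `r` at time `t` is the input plus `z r t`. -/
noncomputable def input (S : Scheme ℓ T h) (b : ℕ → Bool) (z : ℕ → ℕ → ℝ) : ℕ → ℕ → ℝ
  | 0, t => S.source t (fun i => b i, fun s : Fin t => S.input b z 0 s + z 0 s)
  | r + 1, t => S.relay r t
      (fun s : Fin (h.avail t) => S.input b z r s + z r s,
        fun s : Fin t => S.input b z (r + 1) s + z (r + 1) s)
termination_by r t => (r, t)
decreasing_by
  · exact Prod.Lex.right _ s.isLt
  · exact Prod.Lex.left _ _ (Nat.lt_succ_self r)
  · exact Prod.Lex.right _ s.isLt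

/-- The output of channel `r` at time `t`. -/
noncomputable def output (S : Scheme ℓ T h) (b : ℕ → Bool) (z : ℕ → ℕ → ℝ) (r t : ℕ) : ℝ :=
  S.input b z r t + z r t

/-- The estimate of bit `n` at node `r + 1` at time `t`. -/
noncomputable def estimate (S : Scheme ℓ T h) (b : ℕ → Bool) (z : ℕ → ℕ → ℝ) (r n t : ℕ) : Bool :=
  S.decoder r n t
    (fun s : Fin (t + 1) => S.output b z r s, fun s : Fin t => S.output b z (r + 1) s)

variable {Ω : Type*} [MeasurableSpace Ω]

/-- The mean power constraint: `E[X_r(t)²] ≤ P` for all channels `r` and times `t`. -/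
def PowerConstraint (S : Scheme ℓ T h) (μ : Measure Ω) (b : ℕ → Ω → Bool) (Z : ℕ → ℕ → Ω → ℝ)
    (P : ℝ) : Prop :=
  ∀ r t, ∫⁻ ω, ENNReal.ofReal (S.input (fun i => b i ω) (fun r t => Z r t ω) r t ^ 2) ∂μ
    ≤ ENNReal.ofReal P

/-- The error probability of bit `n` at node `r + 1` at time `t`. -/
noncomputable def bitError (S : Scheme ℓ T h) (μ : Measure Ω) (b : ℕ → Ω → Bool)
    (Z : ℕ → ℕ → Ω → ℝ) (r n t : ℕ) : ENNReal :=
  μ {ω | S.estimate (fun i => b i ω) (fun r t => Z r t ω) r n t ≠ b n ω}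

/-- The maximal bit error probability at node `r + 1` with detection delay `Δ`: the supremum over
all packets `τ` and all bits `n` of packet `τ` of the error probability of bit `n` at time
`τ T + Δ`. -/
noncomputable def maxBitError (S : Scheme ℓ T h) (μ : Measure Ω) (b : ℕ → Ω → Bool)
    (Z : ℕ → ℕ → Ω → ℝ) (r Δ : ℕ) : ENNReal :=
  ⨆ (τ : ℕ), ⨆ n ∈ Finset.Ico (τ * ℓ) ((τ + 1) * ℓ), S.bitError μ b Z r n (τ * T + Δ)

end Scheme

variable {Ω : Type*} [MeasurableSpace Ω]

/-- The streaming velocity `v` is achievable: under the power constraint, some scheme has a maximal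
bit error probability at node `r` with delay `⌊r / v⌋` that vanishes as `r → ∞`. -/
def Achievable (μ : Measure Ω) (b : ℕ → Ω → Bool) (Z : ℕ → ℕ → Ω → ℝ) (P : ℝ) (ℓ T : ℕ)
    (h : Hops) (v : ℝ) : Prop :=
  ∃ S : Scheme ℓ T h, S.PowerConstraint μ b Z P ∧
    Tendsto (fun r : ℕ => S.maxBitError μ b Z r ⌊((r + 1 : ℕ) : ℝ) / v⌋₊) atTop (𝓝 0)

/-- The streaming information velocity: the supremum, in `[0, ∞]`, of the achievable positive
velocities (it is `0` if there are none). -/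
noncomputable def streamingIV (μ : Measure Ω) (b : ℕ → Ω → Bool) (Z : ℕ → ℕ → Ω → ℝ) (P : ℝ)
    (ℓ T : ℕ) (h : Hops) : ENNReal :=
  ⨆ (v : ℝ) (_ : 0 < v ∧ Achievable μ b Z P ℓ T h v), ENNReal.ofReal v

end CascadeIV

namespace CascadeIV

open MeasureTheory ProbabilityTheory Filter Topology

/-! ### Innovations coding over one hop -/

/-! The bits are carried by the signal `∑ a ^ n * antipodal (b n)` with `a = exp (-ρ T / ℓ)` and `R
< ρ < C`. Since `ρ > R` means `a < 1 / 2`, each bit can be read off greedily from a good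
approximation of the signal (`greedy_decode`). The increment at time `t` has energy at most `ℓ g ^
t`, where `g = exp (-2 ρ)`.

Every node tracks the estimate of the node before it by sending the amplified tracking error. By the
orthogonality principle the outputs of a hop are uncorrelated (`IsWhiteHop.white`), so each estimate
again has orthogonal increments, orthogonal to the noises further on, and every hop obeys the same
energy recursion (`IsWhiteCascade.isWhiteHop_and`). Only second moments enter, hence the arbitrary
noise law. As `ρ < C` means `1 / (1 + P) < g`, a hop merely multiplies a bound `K g ^ t` by the
constant `Hops.growth` (`inEnergy_le`), and the total error behind channel `r` has energy of order
at most `(2 r + 1)² growth ^ r g ^ t`.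

Chebyshev's inequality compares this with `a ^ (2 n)`. The packet time cancels, leaving `(2 r + 1)²
growth ^ r g ^ Δ` up to a constant (`maxBitError_le`); this vanishes for `Δ ≈ r / v` if `v log
growth < 2 ρ`. By continuity the condition may be checked at `ρ = R`, where `log x ≤ x - 1` and `1 -
exp (-2 R) < 2 R` give it for the claimed velocities themselves (`velocity_mul_log_growth_lt`). -/

/-- Amplification of an error signal of energy `d` to power `P`. -/
noncomputable def gain (P d : ℝ) : ℝ := √(P / d)

/-- Coefficient of the linear MMSE estimate of an error signal of energy `d` from the output of
the unit-variance channel that is fed with `gain P d` times this signal. -/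
noncomputable def mmseCoef (P d : ℝ) : ℝ := gain P d * d / (1 + P)

section Gain

variable {P d : ℝ}

lemma gain_sq_mul_le (hP : 0 < P) (hd : 0 ≤ d) : gain P d ^ 2 * d ≤ P := by
  unfold gain
  rw [Real.sq_sqrt (by positivity)]
  rcases hd.eq_or_lt with rfl | h
  · simpa using hP.le
  · rw [div_mul_cancel₀ _ h.ne']

lemma gain_mul_self_mul (hP : 0 < P) (hd : 0 ≤ d) : gain P d * gain P d * d * d = P * d := by
  unfold gain
  rw [Real.mul_self_sqrt (by positivity)]
  rcases hd.eq_or_lt with rfl | h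
  · simp
  · rw [div_mul_cancel₀ _ h.ne']

lemma gain_mul_mmseCoef_mul (hP : 0 < P) (hd : 0 ≤ d) :
    gain P d * mmseCoef P d * d = P / (1 + P) * d := by
  unfold mmseCoef
  have := gain_mul_self_mul hP hd
  field_simp
  linarith

/-- The normal equation of the MMSE estimate: the left side is the correlation of error and output,
the bracket the output energy. For `d = 0` division by zero makes both coefficients vanish, so no
strict positivity is needed. -/
lemma gain_mul_eq (hP : 0 < P) (hd : 0 ≤ d) :
    gain P d * d = mmseCoef P d * (gain P d ^ 2 * d + 1) := by
  unfold mmseCoef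
  have := gain_mul_self_mul hP hd
  have h1 : gain P d * (gain P d * gain P d * d * d) = gain P d * (P * d) := by rw [this]
  field_simp
  linarith

end Gain

/-- The energy of the tracking error of a source with independent increments of energies `e`, when
at each time the tracking error is sent over a channel of power `P`. -/
noncomputable def trackEnergy (P : ℝ) (e : ℕ → ℝ) : ℕ → ℝ
  | 0 => e 0
  | t + 1 => trackEnergy P e t / (1 + P) + e (t + 1)

lemma trackEnergy_nonneg {P : ℝ} (hP : 0 < P) {e : ℕ → ℝ} (he : ∀ t, 0 ≤ e t) (t : ℕ) :
    0 ≤ trackEnergy P e t := by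
  induction t with
  | zero => exact he 0
  | succ t ih => have := he (t + 1); rw [trackEnergy]; positivity

section Hop

variable {V : Type*} [AddCommGroup V] [Module ℝ V]

/-- `y` is the output, for the noise `z`, of a channel whose input is the amplified difference of
the cumulated increments `I` and of their estimate from the past outputs. -/
def IsHopOutput (P : ℝ) (d : ℕ → ℝ) (I z y : ℕ → V) : Prop :=
  ∀ t, y t = gain P (d t) •
    (∑ s ∈ Finset.range (t + 1), I s - ∑ s ∈ Finset.range t, mmseCoef P (d s) • y s) + z t

/-- The tracking error before the output at time `t` is used. -/
noncomputable def hopError (P : ℝ) (d : ℕ → ℝ) (I y : ℕ → V) (t : ℕ) : V :=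
  ∑ s ∈ Finset.range (t + 1), I s - ∑ s ∈ Finset.range t, mmseCoef P (d s) • y s

lemma hopError_succ (P : ℝ) (d : ℕ → ℝ) (I y : ℕ → V) (t : ℕ) :
    hopError P d I y (t + 1) = (hopError P d I y t - mmseCoef P (d t) • y t) + I (t + 1) := by
  unfold hopError
  rw [Finset.sum_range_succ _ (t + 1),
    Finset.sum_range_succ (fun s => mmseCoef P (d s) • y s) t]
  abel

namespace IsHopOutput

variable {P : ℝ} {d : ℕ → ℝ} {I z y : ℕ → V} {B : LinearMap.BilinForm ℝ V}

lemma eq (h : IsHopOutput P d I z y) (t : ℕ) :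
    y t = gain P (d t) • hopError P d I y t + z t := h t

/-- Unrolling the feedback, `y k` is a linear combination of the increments and noises up to time
`k`. -/
lemma orthogonal (h : IsHopOutput P d I z y) (v : V) (k : ℕ)
    (hI : ∀ s ≤ k, B v (I s) = 0) (hz : ∀ s ≤ k, B v (z s) = 0) : B v (y k) = 0 := by
  induction k using Nat.strong_induction_on with
  | _ k ih =>
    rw [h k, map_add, hz k le_rfl, map_smul, map_sub, map_sum, map_sum,
      Finset.sum_eq_zero, Finset.sum_eq_zero]
    · simp
    · intro s hs
      have hs' := Finset.mem_range.1 hs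
      rw [map_smul, ih s hs' (fun u hu => hI u (by omega)) (fun u hu => hz u (by omega)),
        smul_zero]
    · intro s hs
      have hs' := Finset.mem_range.1 hs
      exact hI s (by omega)

lemma orthogonal_hopError (h : IsHopOutput P d I z y) (v : V) (k : ℕ)
    (hI : ∀ s ≤ k, B v (I s) = 0) (hz : ∀ s < k, B v (z s) = 0) :
    B v (hopError P d I y k) = 0 := by
  rw [hopError, map_sub, map_sum, map_sum, Finset.sum_eq_zero, Finset.sum_eq_zero, sub_zero]
  · intro s hs
    have hs' := Finset.mem_range.1 hs
    rw [map_smul, h.orthogonal v s (fun u hu => hI u (by omega)) (fun u hu => hz u (by omega)),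
      smul_zero]
  · intro s hs
    have hs' := Finset.mem_range.1 hs
    exact hI s (by omega)

lemma noise_hopError (h : IsHopOutput P d I z y) (hB : ∀ u v, B u v = B v u)
    (hIz : ∀ s t, B (I s) (z t) = 0) (hz : ∀ s t, B (z s) (z t) = if s = t then 1 else 0)
    (t : ℕ) : B (z t) (hopError P d I y t) = 0 :=
  h.orthogonal_hopError _ _ (fun s _ => by rw [hB, hIz])
    (fun s hs => by rw [hz, if_neg (by omega)])

end IsHopOutput

/-- Innovations coding of a signal with orthogonal increments over a channel with orthonormal
noise; `d` are the energies of the tracking errors. -/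
structure IsWhiteHop (B : LinearMap.BilinForm ℝ V) (P : ℝ) (d : ℕ → ℝ) (I z y : ℕ → V) :
    Prop where
  output : IsHopOutput P d I z y
  symm : ∀ u v, B u v = B v u
  pos : 0 < P
  nonneg : ∀ t, 0 ≤ d t
  energy : d = trackEnergy P fun t => B (I t) (I t)
  incr_white : ∀ s t, s ≠ t → B (I s) (I t) = 0
  incr_noise : ∀ s t, B (I s) (z t) = 0
  noise : ∀ s t, B (z s) (z t) = if s = t then 1 else 0

namespace IsWhiteHop

variable {P : ℝ} {d : ℕ → ℝ} {I z y : ℕ → V} {B : LinearMap.BilinForm ℝ V}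

/-- The residual after the output at time `t` is orthogonal to all outputs so far and keeps the
fraction `1 / (1 + P)` of the energy; the next increment is orthogonal to everything before it, so
it adds its energy and preserves orthogonality. Orthogonality at `t + 1` uses the energy at `t`,
hence the joint induction. -/
lemma energy_hopError_and (h : IsWhiteHop B P d I z y) (t : ℕ) :
    B (hopError P d I y t) (hopError P d I y t) = d t ∧
      ∀ s < t, B (hopError P d I y t) (y s) = 0 := by
  induction t with
  | zero => simp [hopError, h.energy, trackEnergy]
  | succ t ih =>
    obtain ⟨ihd, ihy⟩ := ih
    have hzD := h.output.noise_hopError h.symm h.incr_noise h.noise t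
    have hIy : ∀ s ≤ t, B (I (t + 1)) (y s) = 0 := fun s hs =>
      h.output.orthogonal _ _ (fun u hu => h.incr_white _ _ (by omega))
        (fun u hu => h.incr_noise _ _)
    have hID : B (I (t + 1)) (hopError P d I y t) = 0 :=
      h.output.orthogonal_hopError _ _ (fun u hu => h.incr_white _ _ (by omega))
        (fun u hu => h.incr_noise _ _)
    have hzy : ∀ s < t, B (z t) (y s) = 0 := fun s hs =>
      h.output.orthogonal _ _ (fun u _ => by rw [h.symm, h.incr_noise])
        (fun u hu => by rw [h.noise, if_neg (by omega)])
    have hDy : B (hopError P d I y t) (y t) = gain P (d t) * d t := by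
      rw [h.output.eq t, map_add, map_smul, ihd, h.symm _ (z t), hzD, smul_eq_mul, add_zero]
    have hyy : B (y t) (y t) = gain P (d t) ^ 2 * d t + 1 := by
      have h1 : B (z t) (y t) = 1 := by
        rw [h.output.eq t, map_add, map_smul, hzD, h.noise]; simp
      nth_rw 1 [h.output.eq t]
      rw [map_add, map_smul, LinearMap.add_apply, LinearMap.smul_apply, hDy, h1, smul_eq_mul]
      ring
    have e1 := gain_mul_eq h.pos (h.nonneg t)
    have e2 := gain_mul_mmseCoef_mul h.pos (h.nonneg t)
    rw [hopError_succ]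
    refine ⟨?_, fun s hs => ?_⟩
    · have hIt : B (I (t + 1)) (I (t + 1)) = d (t + 1) - d t / (1 + P) := by
        rw [h.energy]; simp [trackEnergy]
      simp only [map_add, map_sub, map_smul, LinearMap.add_apply, LinearMap.sub_apply,
        LinearMap.smul_apply, smul_eq_mul, hIt, hID, hIy t le_rfl, h.symm _ (I (t + 1)), hDy, hyy,
        h.symm (y t) (hopError P d I y t), ihd]
      have hP := h.pos
      have e3 : d t - P / (1 + P) * d t = d t / (1 + P) := by field_simp; ring
      linear_combination (-mmseCoef P (d t)) * e1 - e2 + e3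
    · simp only [map_add, map_sub, map_smul, LinearMap.add_apply, LinearMap.sub_apply,
        LinearMap.smul_apply, smul_eq_mul]
      rcases Nat.lt_succ_iff_lt_or_eq.1 hs with hs | rfl
      · have : B (y t) (y s) = 0 := by
          nth_rw 1 [h.output.eq t]
          simp [ihy s hs, hzy s hs]
        rw [ihy s hs, this, hIy s hs.le]
        simp
      · rw [hDy, hyy, hIy s le_rfl]
        linear_combination e1

lemma energy_hopError (h : IsWhiteHop B P d I z y) (t : ℕ) :
    B (hopError P d I y t) (hopError P d I y t) = d t :=
  (h.energy_hopError_and t).1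

/-- Both parts of the later output, tracking error and fresh noise, are orthogonal to earlier
outputs. This lets the estimate serve as the source of the next hop. -/
lemma white (h : IsWhiteHop B P d I z y) (s t : ℕ) (hst : s ≠ t) : B (y s) (y t) = 0 := by
  wlog hlt : t < s generalizing s t
  · rw [h.symm]; exact this t s hst.symm (by omega)
  rw [h.output.eq s, map_add, map_smul, LinearMap.add_apply, LinearMap.smul_apply,
    (h.energy_hopError_and s).2 t hlt,
    h.output.orthogonal (z s) t (fun u _ => by rw [h.symm, h.incr_noise])
      (fun u hu => by rw [h.noise, if_neg (by omega)])]
  simp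

lemma hopError_output (h : IsWhiteHop B P d I z y) (t : ℕ) :
    B (hopError P d I y t) (y t) = gain P (d t) * d t := by
  rw [h.output.eq t, map_add, map_smul, h.energy_hopError, h.symm _ (z t),
    h.output.noise_hopError h.symm h.incr_noise h.noise, smul_eq_mul, add_zero]

lemma output_output (h : IsWhiteHop B P d I z y) (t : ℕ) :
    B (y t) (y t) = gain P (d t) ^ 2 * d t + 1 := by
  have h1 : B (z t) (y t) = 1 := by
    rw [h.output.eq t, map_add, map_smul, h.output.noise_hopError h.symm h.incr_noise h.noise,
      h.noise]
    simp
  nth_rw 1 [h.output.eq t]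
  rw [map_add, map_smul, LinearMap.add_apply, LinearMap.smul_apply,
    h.hopError_output, h1, smul_eq_mul]
  ring

lemma energy_estimate_increment (h : IsWhiteHop B P d I z y) (t : ℕ) :
    B (mmseCoef P (d t) • y t) (mmseCoef P (d t) • y t) = P / (1 + P) * d t := by
  simp only [map_smul, LinearMap.smul_apply, smul_eq_mul,
    h.output_output]
  linear_combination (-mmseCoef P (d t)) * gain_mul_eq h.pos (h.nonneg t) +
    gain_mul_mmseCoef_mul h.pos (h.nonneg t)

lemma energy_residual (h : IsWhiteHop B P d I z y) (t : ℕ) :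
    B (hopError P d I y t - mmseCoef P (d t) • y t) (hopError P d I y t - mmseCoef P (d t) • y t)
      = d t / (1 + P) := by
  simp only [map_sub, map_smul, LinearMap.sub_apply, LinearMap.smul_apply, smul_eq_mul,
    h.output_output, h.symm (y t) (hopError P d I y t),
    h.hopError_output, h.energy_hopError]
  have hP := h.pos
  have e3 : d t - P / (1 + P) * d t = d t / (1 + P) := by field_simp; ring
  linear_combination (-mmseCoef P (d t)) * gain_mul_eq h.pos (h.nonneg t) -
    gain_mul_mmseCoef_mul h.pos (h.nonneg t) + e3

end IsWhiteHop

end Hop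

/-! ### Innovations coding over the cascade -/

/-- The increments of the signal that a relay tracks, when `f` are the increments of its estimate:
the latter reach the channel input at once or one time step later. -/
def Hops.incr {V : Type*} [Zero V] : Hops → (ℕ → V) → ℕ → V
  | .instantaneous, f, t => f t
  | .delayed, _, 0 => 0
  | .delayed, f, t + 1 => f t

/-- A delay amounts to an extra zero increment at time `0`, so both kinds of hops run the same
innovations coding. -/
lemma Hops.sum_incr {V : Type*} [AddCommMonoid V] (h : Hops) (f : ℕ → V) (t : ℕ) :
    ∑ s ∈ Finset.range (t + 1), h.incr f s = ∑ s ∈ Finset.range (h.avail t), f s := by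
  cases h with
  | instantaneous => rfl
  | delayed => rw [Finset.sum_range_succ']; simp [Hops.incr, Hops.avail]

/-- The energies of the increments of the signal that is tracked over channel `r`, if the increments
of the source have energies `e`. -/
noncomputable def inEnergy (P : ℝ) (h : Hops) (e : ℕ → ℝ) : ℕ → ℕ → ℝ
  | 0 => e
  | r + 1 => h.incr fun t => P / (1 + P) * trackEnergy P (inEnergy P h e r) t

/-- The energies of the tracking errors over channel `r`. -/
noncomputable def hopEnergy (P : ℝ) (h : Hops) (e : ℕ → ℝ) (r : ℕ) : ℕ → ℝ :=
  trackEnergy P (inEnergy P h e r)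

/-! ### Geometric bounds on the error energies -/

section Energy

variable {P : ℝ} {e : ℕ → ℝ}

lemma inEnergy_nonneg (hP : 0 < P) (h : Hops) (he : ∀ t, 0 ≤ e t) (r t : ℕ) :
    0 ≤ inEnergy P h e r t := by
  induction r generalizing t with
  | zero => exact he t
  | succ r ih =>
    have key (t : ℕ) : 0 ≤ P / (1 + P) * trackEnergy P (inEnergy P h e r) t := by
      have := trackEnergy_nonneg hP ih t
      positivity
    cases h with
    | instantaneous => exact key t
    | delayed =>
      cases t with
      | zero => exact le_rfl
      | succ t => exact key t

lemma hopEnergy_nonneg (hP : 0 < P) (h : Hops) (he : ∀ t, 0 ≤ e t) (r t : ℕ) :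
    0 ≤ hopEnergy P h e r t :=
  trackEnergy_nonneg hP (inEnergy_nonneg hP h he r) t

/-- Amplification of the geometrically weighted tracking errors by one hop. -/
noncomputable def Hops.growth (P g : ℝ) : Hops → ℝ
  | .instantaneous => P / (1 + P) / (1 - 1 / (1 + P) / g)
  | .delayed => P / (1 + P) / (1 - 1 / (1 + P) / g) / g

/-- The constant `A = K / (1 - 1 / (1 + P) / g)` solves `A / (1 + P) / g + K = A`, so `A g ^ t`
reproduces itself under the recursion. -/
lemma trackEnergy_le (hP : 0 < P) {g K : ℝ} (hK : 0 ≤ K) (hg : 1 / (1 + P) < g)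
    (he : ∀ t, e t ≤ K * g ^ t) (t : ℕ) :
    trackEnergy P e t ≤ K / (1 - 1 / (1 + P) / g) * g ^ t := by
  have hq : 0 < 1 / (1 + P) := by positivity
  have hg0 : 0 < g := hq.trans hg
  have hc : 0 < 1 - 1 / (1 + P) / g := by rw [sub_pos, div_lt_one hg0]; exact hg
  induction t with
  | zero =>
    refine (he 0).trans ?_
    rw [pow_zero, mul_one, mul_one]
    exact le_div_self hK hc (by have : 0 < 1 / (1 + P) / g := by positivity
                                linarith)
  | succ t ih =>
    rw [trackEnergy]
    calc trackEnergy P e t / (1 + P) + e (t + 1)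
        ≤ K / (1 - 1 / (1 + P) / g) * g ^ t / (1 + P) + K * g ^ (t + 1) := by
          gcongr
          exact he _
      _ = K / (1 - 1 / (1 + P) / g) * g ^ (t + 1) := by
          have h1 : K = K / (1 - 1 / (1 + P) / g) * (1 - 1 / (1 + P) / g) := by
            rw [div_mul_cancel₀ _ hc.ne']
          generalize K / (1 - 1 / (1 + P) / g) = A at h1
          rw [h1, pow_succ]
          field_simp
          ring

lemma Hops.growth_pos (h : Hops) (hP : 0 < P) {g : ℝ} (hg : 1 / (1 + P) < g) :
    0 < h.growth P g := by
  have hq : 0 < 1 / (1 + P) := by positivity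
  have hg0 : 0 < g := hq.trans hg
  have hc : 0 < 1 - 1 / (1 + P) / g := by rw [sub_pos, div_lt_one hg0]; exact hg
  cases h <;> unfold Hops.growth <;> positivity

/-- Lets the energy bound of channel `r` dominate those of all channels before it. -/
lemma Hops.one_le_growth (h : Hops) (hP : 0 < P) {g : ℝ} (hg : 1 / (1 + P) < g) (hg1 : g ≤ 1) :
    1 ≤ h.growth P g := by
  have hq : 0 < 1 / (1 + P) := by positivity
  have hg0 : 0 < g := hq.trans hg
  have hc : 0 < 1 - 1 / (1 + P) / g := by rw [sub_pos, div_lt_one hg0]; exact hg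
  have h1 : 1 ≤ P / (1 + P) / (1 - 1 / (1 + P) / g) := by
    rw [one_le_div hc]
    have h2 : 1 / (1 + P) ≤ 1 / (1 + P) / g := le_div_self hq.le hg0 hg1
    have h3 : P / (1 + P) = 1 - 1 / (1 + P) := by field_simp; ring
    linarith
  cases h
  · exact h1
  · exact h1.trans (le_div_self (by linarith) hg0 hg1)

/-- A hop passes on the fraction `P / (1 + P)` of its tracking energy; a delay shifts time by one,
which costs a further factor `1 / g`. -/
lemma inEnergy_le (hP : 0 < P) (h : Hops) {g K : ℝ} (hK : 0 ≤ K) (hg : 1 / (1 + P) < g)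
    (he : ∀ t, e t ≤ K * g ^ t) (r t : ℕ) :
    inEnergy P h e r t ≤ K * h.growth P g ^ r * g ^ t := by
  have hq : 0 < 1 / (1 + P) := by positivity
  have hg0 : 0 < g := hq.trans hg
  induction r generalizing t with
  | zero => simpa [inEnergy] using he t
  | succ r ih =>
    have hG := h.growth_pos hP hg
    have key (t : ℕ) : P / (1 + P) * trackEnergy P (inEnergy P h e r) t
        ≤ P / (1 + P) * (K * h.growth P g ^ r / (1 - 1 / (1 + P) / g) * g ^ t) := by
      have := trackEnergy_le hP (K := K * h.growth P g ^ r) (by positivity) hg ih t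
      gcongr
    cases h with
    | instantaneous =>
      refine (key t).trans (le_of_eq ?_)
      rw [pow_succ]
      nth_rw 3 [Hops.growth]
      ring
    | delayed =>
      cases t with
      | zero => simp only [inEnergy, Hops.incr]; positivity
      | succ t =>
        refine (key t).trans (le_of_eq ?_)
        rw [pow_succ (Hops.growth P g .delayed)]
        nth_rw 3 [Hops.growth]
        rw [pow_succ]
        field_simp

lemma hopEnergy_le (hP : 0 < P) (h : Hops) {g K : ℝ} (hK : 0 ≤ K) (hg : 1 / (1 + P) < g)
    (he : ∀ t, e t ≤ K * g ^ t) (r t : ℕ) :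
    hopEnergy P h e r t ≤ K * h.growth P g ^ r / (1 - 1 / (1 + P) / g) * g ^ t := by
  have hG := h.growth_pos hP hg
  exact trackEnergy_le hP (by positivity) hg (inEnergy_le hP h hK hg he r) t

end Energy

/-! ### Orthogonality and total error along the cascade -/

section Cascade

variable {V : Type*} [AddCommGroup V] [Module ℝ V]

/-- The increments of the signal that is tracked over channel `r`. -/
noncomputable def hopIncr (P : ℝ) (h : Hops) (d : ℕ → ℕ → ℝ) (w : ℕ → V) (y : ℕ → ℕ → V) :
    ℕ → ℕ → V
  | 0 => w
  | r + 1 => h.incr fun t => mmseCoef P (d r t) • y r t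

/-- All nodes of a cascade perform innovations coding; `w` are the increments of the source. -/
def IsCascadeOutput (P : ℝ) (h : Hops) (d : ℕ → ℕ → ℝ) (w : ℕ → V) (z y : ℕ → ℕ → V) : Prop :=
  ∀ r, IsHopOutput P (d r) (hopIncr P h d w y r) (z r) (y r)

variable {h : Hops} {B : LinearMap.BilinForm ℝ V}

lemma apply_incr_eq_zero {f : ℕ → V} {v : V} (hf : ∀ t, B v (f t) = 0) (t : ℕ) :
    B v (h.incr f t) = 0 := by
  cases h with
  | instantaneous => exact hf t
  | delayed =>
    cases t with
    | zero => simp [Hops.incr]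
    | succ t => exact hf t

lemma incr_white {f : ℕ → V} (hf : ∀ s t, s ≠ t → B (f s) (f t) = 0)
    (s t : ℕ) (hst : s ≠ t) : B (h.incr f s) (h.incr f t) = 0 := by
  cases h with
  | instantaneous => exact hf s t hst
  | delayed =>
    cases s with
    | zero => simp [Hops.incr]
    | succ s =>
      cases t with
      | zero => simp [Hops.incr]
      | succ t => exact hf s t (by omega)

lemma energy_incr (f : ℕ → V) (t : ℕ) :
    B (h.incr f t) (h.incr f t) = h.incr (fun t => B (f t) (f t)) t := by
  cases h with
  | instantaneous => rfl
  | delayed => cases t <;> simp [Hops.incr]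

/-- The triangle inequality for the seminorm of a positive semidefinite form. -/
lemma apply_add_self_le (hB : ∀ u v, B u v = B v u) (hB0 : ∀ v, 0 ≤ B v v) {M a b : ℝ}
    (ha : 0 < a) (hb : 0 < b) {u v : V} (hu : B u u ≤ a ^ 2 * M) (hv : B v v ≤ b ^ 2 * M) :
    B (u + v) (u + v) ≤ (a + b) ^ 2 * M := by
  -- Nonnegativity at `b • u - a • v` bounds the cross term without square roots.
  have h1 := hB0 (b • u - a • v)
  simp only [map_add, map_sub, map_smul, LinearMap.add_apply, LinearMap.sub_apply,
    LinearMap.smul_apply, smul_eq_mul, hB v u] at h1 ⊢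
  have h2 : a * b * B u v ≤ a * b * (a * b * M) := by
    nlinarith [mul_le_mul_of_nonneg_left hu (sq_nonneg b),
      mul_le_mul_of_nonneg_left hv (sq_nonneg a)]
  have h3 := le_of_mul_le_mul_left h2 (mul_pos ha hb)
  nlinarith

/-- Innovations coding over a cascade, for a source with orthogonal increments `w` of energies `e`
and orthonormal noises `z`. -/
structure IsWhiteCascade (B : LinearMap.BilinForm ℝ V) (P : ℝ) (h : Hops) (e : ℕ → ℝ) (w : ℕ → V)
    (z y : ℕ → ℕ → V) : Prop where
  output : IsCascadeOutput P h (hopEnergy P h e) w z y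
  symm : ∀ u v, B u v = B v u
  pos : 0 < P
  energy : ∀ t, B (w t) (w t) = e t
  nonneg : ∀ t, 0 ≤ e t
  source_white : ∀ s t, s ≠ t → B (w s) (w t) = 0
  source_noise : ∀ s r t, B (w s) (z r t) = 0
  noise : ∀ r s t, B (z r s) (z r t) = if s = t then 1 else 0
  noise_white : ∀ r r' s t, r ≠ r' → B (z r s) (z r' t) = 0

namespace IsWhiteCascade

variable {P : ℝ} {h : Hops} {e : ℕ → ℝ} {w : ℕ → V} {z y : ℕ → ℕ → V}
  {B : LinearMap.BilinForm ℝ V}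

/-- Induction over the hops: the outputs of channel `r` are white and involve only the source and
noises of channels up to `r`, so the scaled outputs are an admissible source for channel `r + 1`. -/
lemma isWhiteHop_and (hc : IsWhiteCascade B P h e w z y) (r : ℕ) :
    (∀ t, B (hopIncr P h (hopEnergy P h e) w y r t) (hopIncr P h (hopEnergy P h e) w y r t)
      = inEnergy P h e r t) ∧
    (∀ r', r ≤ r' → ∀ s t, B (hopIncr P h (hopEnergy P h e) w y r s) (z r' t) = 0) ∧
    IsWhiteHop B P (hopEnergy P h e r) (hopIncr P h (hopEnergy P h e) w y r) (z r) (y r) := by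
  have mk (r : ℕ)
      (h1 : ∀ t, B (hopIncr P h (hopEnergy P h e) w y r t) (hopIncr P h (hopEnergy P h e) w y r t)
        = inEnergy P h e r t)
      (h2 : ∀ r', r ≤ r' → ∀ s t, B (hopIncr P h (hopEnergy P h e) w y r s) (z r' t) = 0)
      (h3 : ∀ s t, s ≠ t → B (hopIncr P h (hopEnergy P h e) w y r s)
        (hopIncr P h (hopEnergy P h e) w y r t) = 0) :
      IsWhiteHop B P (hopEnergy P h e r) (hopIncr P h (hopEnergy P h e) w y r) (z r) (y r) :=
    { output := hc.output r
      symm := hc.symm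
      pos := hc.pos
      nonneg := hopEnergy_nonneg hc.pos h hc.nonneg r
      energy := by simp only [h1]; rfl
      incr_white := h3
      incr_noise := h2 r le_rfl
      noise := hc.noise r }
  induction r with
  | zero =>
    exact ⟨hc.energy, fun r' _ s t => hc.source_noise s r' t,
      mk 0 hc.energy (fun r' _ s t => hc.source_noise s r' t) hc.source_white⟩
  | succ r ih =>
    obtain ⟨-, ih2, ih3⟩ := ih
    have h1 (t : ℕ) : B (hopIncr P h (hopEnergy P h e) w y (r + 1) t)
        (hopIncr P h (hopEnergy P h e) w y (r + 1) t) = inEnergy P h e (r + 1) t := by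
      refine (energy_incr _ t).trans ?_
      simp only [ih3.energy_estimate_increment]
      rfl
    have h2 (r' : ℕ) (hr' : r + 1 ≤ r') (s t : ℕ) :
        B (hopIncr P h (hopEnergy P h e) w y (r + 1) s) (z r' t) = 0 := by
      rw [hc.symm]
      refine apply_incr_eq_zero (fun u => ?_) s
      rw [map_smul, ih3.output.orthogonal (z r' t) u
        (fun k _ => by rw [hc.symm, ih2 r' (by omega)])
        (fun k _ => hc.noise_white _ _ _ _ (by omega)), smul_zero]
    refine ⟨h1, h2, mk (r + 1) h1 h2 (incr_white fun s t hst => ?_)⟩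
    simp [ih3.white s t hst]

lemma isWhiteHop (hc : IsWhiteCascade B P h e w z y) (r : ℕ) :
    IsWhiteHop B P (hopEnergy P h e r) (hopIncr P h (hopEnergy P h e) w y r) (z r) (y r) :=
  (hc.isWhiteHop_and r).2.2

/-- The error telescopes into `r + 1` tracking residuals and `r` gaps between an estimate and the
part of it that has reached the next input (zero without delay, one increment with delay). Each has
norm at most `√M`, whence `2 r + 1` by the triangle inequality. -/
lemma energy_error_le (hc : IsWhiteCascade B P h e w z y) (hB0 : ∀ v, 0 ≤ B v v)
    (r t : ℕ) {M : ℝ} (hM : ∀ j ≤ r, hopEnergy P h e j t ≤ M) :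
    B (∑ s ∈ Finset.range (t + 1), w s
        - ∑ s ∈ Finset.range (t + 1), mmseCoef P (hopEnergy P h e r s) • y r s)
      (∑ s ∈ Finset.range (t + 1), w s
        - ∑ s ∈ Finset.range (t + 1), mmseCoef P (hopEnergy P h e r s) • y r s)
      ≤ (2 * r + 1) ^ 2 * M := by
  have hres (r : ℕ) : B (∑ s ∈ Finset.range (t + 1), hopIncr P h (hopEnergy P h e) w y r s
        - ∑ s ∈ Finset.range (t + 1), mmseCoef P (hopEnergy P h e r s) • y r s)
      (∑ s ∈ Finset.range (t + 1), hopIncr P h (hopEnergy P h e) w y r s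
        - ∑ s ∈ Finset.range (t + 1), mmseCoef P (hopEnergy P h e r s) • y r s)
      ≤ hopEnergy P h e r t := by
    have h1 := (hc.isWhiteHop r).energy_residual t
    rw [hopError, sub_sub, ← Finset.sum_range_succ] at h1
    rw [h1]
    exact div_le_self (hopEnergy_nonneg hc.pos h hc.nonneg r t) (by linarith [hc.pos])
  have hgap (r : ℕ) : B (∑ s ∈ Finset.range (t + 1), mmseCoef P (hopEnergy P h e r s) • y r s
        - ∑ s ∈ Finset.range (t + 1), hopIncr P h (hopEnergy P h e) w y (r + 1) s)
      (∑ s ∈ Finset.range (t + 1), mmseCoef P (hopEnergy P h e r s) • y r s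
        - ∑ s ∈ Finset.range (t + 1), hopIncr P h (hopEnergy P h e) w y (r + 1) s)
      ≤ hopEnergy P h e r t := by
    have hP := hc.pos
    have h0 := hopEnergy_nonneg hP h hc.nonneg r t
    have h1 := (hc.isWhiteHop r).energy_estimate_increment t
    simp only [hopIncr]
    rw [h.sum_incr]
    cases h with
    | instantaneous => simpa [Hops.avail] using h0
    | delayed =>
      rw [Hops.avail, Finset.sum_range_succ, add_sub_cancel_left, h1]
      exact mul_le_of_le_one_left h0 (by rw [div_le_one (by linarith)]; linarith)
  induction r with
  | zero =>
    refine ((hres 0).trans (hM 0 le_rfl)).trans (le_of_eq ?_)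
    simp
  | succ r ih =>
    have h1 := ih fun j hj => hM j (by omega)
    have h2 := apply_add_self_le hc.symm hB0 (M := M) (a := 2 * r + 1) (b := 1) (by positivity)
      one_pos h1 (((hgap r).trans (hM r (by omega))).trans_eq (by ring))
    have h3 := apply_add_self_le hc.symm hB0 (M := M) (a := 2 * r + 1 + 1) (b := 1) (by positivity)
      one_pos h2 (((hres (r + 1)).trans (hM (r + 1) le_rfl)).trans_eq (by ring))
    rw [sub_add_sub_cancel, sub_add_sub_cancel] at h3
    refine h3.trans (le_of_eq ?_)
    push_cast
    ring

end IsWhiteCascade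

end Cascade

/-! ### Signal constellation and greedy decoder -/

/-- Antipodal signalling. -/
def antipodal (c : Bool) : ℝ := if c then 1 else -1

lemma abs_antipodal (c : Bool) : |antipodal c| = 1 := by
  cases c <;> simp [antipodal]

lemma antipodal_mul_self (c : Bool) : antipodal c * antipodal c = 1 := by
  cases c <;> simp [antipodal]

/-- What remains of `v` after the greedy subtraction of `± a ^ m`, `m < n`. -/
noncomputable def greedyResidual (a v : ℝ) : ℕ → ℝ
  | 0 => v
  | n + 1 => greedyResidual a v n - a ^ n * antipodal (decide (0 < greedyResidual a v n))

lemma measurable_antipodal : Measurable antipodal := measurable_of_countable _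

lemma measurable_decide_pos {α : Type*} [MeasurableSpace α] {f : α → ℝ} (hf : Measurable f) :
    Measurable fun x => decide (0 < f x) := by
  refine measurable_to_bool ?_
  have : (fun x => decide (0 < f x)) ⁻¹' {true} = f ⁻¹' Set.Ioi 0 := by ext; simp
  rw [this]
  exact hf measurableSet_Ioi

lemma measurable_greedyResidual (a : ℝ) (n : ℕ) :
    Measurable fun v => greedyResidual a v n := by
  induction n with
  | zero => exact measurable_id
  | succ n ih =>
    exact ih.sub (measurable_const.mul (measurable_antipodal.comp (measurable_decide_pos ih)))

lemma abs_sum_Ico_mul_antipodal_le {a : ℝ} (ha0 : 0 < a) (ha : a < 1) (b : ℕ → Bool) (k N : ℕ) :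
    |∑ m ∈ Finset.Ico k N, a ^ m * antipodal (b m)| ≤ a ^ k / (1 - a) := by
  calc |∑ m ∈ Finset.Ico k N, a ^ m * antipodal (b m)|
      ≤ ∑ m ∈ Finset.Ico k N, |a ^ m * antipodal (b m)| := Finset.abs_sum_le_sum_abs _ _
    _ = ∑ m ∈ Finset.Ico k N, a ^ m := by
        refine Finset.sum_congr rfl fun m _ => ?_
        rw [abs_mul, abs_antipodal, mul_one, abs_of_pos (by positivity)]
    _ ≤ a ^ k / (1 - a) := geom_sum_Ico_le_of_lt_one ha0.le ha

/-- The leading term `a ^ k` exceeds the bound `a ^ (k + 1) / (1 - a)` on all later terms by exactly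
the tolerance in `hx`. -/
lemma decide_pos_eq_of_abs_sub_lt {a : ℝ} (ha0 : 0 < a) (ha : a < 1) (b : ℕ → Bool) {k N : ℕ}
    (hk : k < N) {x : ℝ}
    (hx : |x - ∑ m ∈ Finset.Ico k N, a ^ m * antipodal (b m)| < a ^ k * ((1 - 2 * a) / (1 - a))) :
    decide (0 < x) = b k := by
  rw [Finset.sum_eq_sum_Ico_succ_bot hk] at hx
  have h1 := abs_le.1 (abs_sum_Ico_mul_antipodal_le ha0 ha b (k + 1) N)
  have h2 := abs_lt.1 hx
  have h3 : a ^ k = a ^ k * ((1 - 2 * a) / (1 - a)) + a ^ (k + 1) / (1 - a) := by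
    have : 1 - a ≠ 0 := by linarith
    field_simp
    ring
  cases hb : b k
  · have : antipodal false = -1 := rfl
    rw [hb, this] at h2
    simp only [decide_eq_false_iff_not, not_lt]
    linarith
  · have : antipodal true = 1 := rfl
    rw [hb, this] at h2
    simp only [decide_eq_true_eq]
    linarith

/-- The greedy decoder recovers bit `n` from an accurate enough observation of the signal. -/
lemma greedy_decode {a : ℝ} (ha0 : 0 < a) (ha : a < 1 / 2) (b : ℕ → Bool) {n N : ℕ} (hn : n < N)
    {v : ℝ} (hv : |v - ∑ m ∈ Finset.range N, a ^ m * antipodal (b m)|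
      < a ^ n * ((1 - 2 * a) / (1 - a))) :
    decide (0 < greedyResidual a v n) = b n := by
  have hpos : 0 ≤ (1 - 2 * a) / (1 - a) := div_nonneg (by linarith) (by linarith)
  have key : ∀ k ≤ n,
      greedyResidual a v k = v - ∑ m ∈ Finset.range k, a ^ m * antipodal (b m) →
      decide (0 < greedyResidual a v k) = b k := by
    intro k hk hres
    refine decide_pos_eq_of_abs_sub_lt ha0 (by linarith) b (hk.trans_lt hn) ?_
    rw [hres, sub_sub, Finset.sum_range_add_sum_Ico _ (hk.trans hn.le)]
    -- Tolerances decrease with the bit index, so accuracy for bit `n` suffices for all earlier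
    -- bits.
    refine hv.trans_le (mul_le_mul_of_nonneg_right ?_ hpos)
    exact pow_le_pow_of_le_one ha0.le (by linarith) hk
  have hres : ∀ k ≤ n,
      greedyResidual a v k = v - ∑ m ∈ Finset.range k, a ^ m * antipodal (b m) := by
    intro k
    induction k with
    | zero => simp [greedyResidual]
    | succ k ih =>
      intro hk
      have hk' : k ≤ n := by omega
      rw [greedyResidual, key k hk' (ih hk'), ih hk', Finset.sum_range_succ, sub_sub]
  exact key n le_rfl (hres n le_rfl)

/-! ### The source signal -/

/-- Number of bits that were generated before time `t`. -/
def bitCount (ℓ T : ℕ) : ℕ → ℕ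
  | 0 => 0
  | t + 1 => (t / T + 1) * ℓ

lemma bitCount_mono (ℓ T : ℕ) : Monotone (bitCount ℓ T) := by
  refine monotone_nat_of_le_succ fun t => ?_
  cases t with
  | zero => exact Nat.zero_le _
  | succ t => exact Nat.mul_le_mul_right _ (Nat.succ_le_succ (Nat.div_le_div_right (by omega)))

lemma bitCount_succ_le (ℓ T t : ℕ) : bitCount ℓ T (t + 1) ≤ bitCount ℓ T t + ℓ := by
  cases t with
  | zero => simp [bitCount]
  | succ t =>
    have : (t + 1) / T ≤ t / T + 1 := by
      rw [Nat.succ_div]; split_ifs <;> omega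
    simp only [bitCount]
    calc ((t + 1) / T + 1) * ℓ ≤ (t / T + 1 + 1) * ℓ := by gcongr
      _ = _ := by ring

lemma mul_le_bitCount_mul {ℓ T : ℕ} (hT : 0 < T) (t : ℕ) : t * ℓ ≤ bitCount ℓ T t * T := by
  cases t with
  | zero => simp
  | succ t =>
    have := Nat.lt_div_mul_add hT (a := t)
    simp only [bitCount]
    calc (t + 1) * ℓ ≤ ((t / T + 1) * T) * ℓ := by
          gcongr
          rw [add_mul]
          omega
      _ = _ := by ring

/-- The energy of the signal increment at time `t`. -/
noncomputable def sourceEnergy (ℓ T : ℕ) (a : ℝ) (t : ℕ) : ℝ :=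
  ∑ n ∈ Finset.Ico (bitCount ℓ T t) (bitCount ℓ T (t + 1)), (a ^ n) ^ 2

lemma sourceEnergy_nonneg (ℓ T : ℕ) (a : ℝ) (t : ℕ) : 0 ≤ sourceEnergy ℓ T a t :=
  Finset.sum_nonneg fun _ _ => sq_nonneg _

/-- The signal increment at time `t`, for the message bits `b`. -/
noncomputable def sourceIncr (ℓ T : ℕ) (a : ℝ) (b : ℕ → Bool) (t : ℕ) : ℝ :=
  ∑ n ∈ Finset.Ico (bitCount ℓ T t) (bitCount ℓ T (t + 1)), a ^ n * antipodal (b n)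

lemma sum_sourceIncr (ℓ T : ℕ) (a : ℝ) (b : ℕ → Bool) (t : ℕ) :
    ∑ s ∈ Finset.range t, sourceIncr ℓ T a b s
      = ∑ n ∈ Finset.range (bitCount ℓ T t), a ^ n * antipodal (b n) := by
  induction t with
  | zero => simp [bitCount]
  | succ t ih =>
    rw [Finset.sum_range_succ, ih, sourceIncr,
      Finset.sum_range_add_sum_Ico _ (bitCount_mono ℓ T (Nat.le_succ t))]

/-- At most `ℓ` bits arrive at time `t`, with indices `n ≥ t ℓ / T`, so each contributes at most
`exp (-2 ρ t)`. -/
lemma sourceEnergy_le {ℓ T : ℕ} (hℓ : 0 < ℓ) (hT : 0 < T) {ρ : ℝ} (hρ : 0 ≤ ρ) (t : ℕ) :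
    sourceEnergy ℓ T (Real.exp (-ρ * T / ℓ)) t ≤ ℓ * Real.exp (-2 * ρ) ^ t := by
  have hℓ' : (0 : ℝ) < ℓ := by exact_mod_cast hℓ
  have hcard := bitCount_succ_le ℓ T t
  calc sourceEnergy ℓ T (Real.exp (-ρ * T / ℓ)) t
      ≤ (Finset.Ico (bitCount ℓ T t) (bitCount ℓ T (t + 1))).card • Real.exp (-2 * ρ) ^ t := by
        refine Finset.sum_le_card_nsmul _ _ _ fun n hn => ?_
        have hn1 := (Finset.mem_Ico.1 hn).1
        have h1 : t * ℓ ≤ n * T := (mul_le_bitCount_mul hT t).trans (by gcongr)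
        have h2 : (t : ℝ) * ℓ ≤ n * T := by exact_mod_cast h1
        rw [← Real.exp_nat_mul, ← Real.exp_nat_mul, ← Real.exp_nat_mul]
        refine Real.exp_le_exp.2 ?_
        push_cast
        have h3 : (t : ℝ) ≤ n * T / ℓ := by rwa [le_div_iff₀ hℓ']
        have h4 : (2 : ℝ) * (n * (-ρ * T / ℓ)) = -2 * ρ * (n * T / ℓ) := by ring
        rw [h4]
        nlinarith
    _ ≤ ℓ * Real.exp (-2 * ρ) ^ t := by
        rw [nsmul_eq_mul, Nat.card_Ico]
        gcongr
        omega

/-! ### The scheme -/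

/-- Innovations coding by all nodes of the cascade: a node sends the amplified difference of its own
estimate of the signal and of that of the next node. -/
noncomputable def innovationsScheme (ℓ T : ℕ) (h : Hops) (P a : ℝ) (d : ℕ → ℕ → ℝ) :
    Scheme ℓ T h where
  source t x := gain P (d 0 t) *
    (∑ i : Fin ((t / T + 1) * ℓ), a ^ (i : ℕ) * antipodal (x.1 i)
      - ∑ s : Fin t, mmseCoef P (d 0 s) * x.2 s)
  relay r t x := gain P (d (r + 1) t) *
    (∑ s : Fin (h.avail t), mmseCoef P (d r s) * x.1 s
      - ∑ s : Fin t, mmseCoef P (d (r + 1) s) * x.2 s)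
  decoder r n t x := decide (0 < greedyResidual a (∑ s : Fin (t + 1), mmseCoef P (d r s) * x.1 s) n)
  measurable_source t := by
    have := measurable_antipodal
    fun_prop
  measurable_relay r t := by fun_prop
  measurable_decoder r n t :=
    measurable_decide_pos ((measurable_greedyResidual a n).comp (by fun_prop))

section Scheme

variable {ℓ T : ℕ} {h : Hops} {P a : ℝ} {d : ℕ → ℕ → ℝ}

lemma innovationsScheme_input (b : ℕ → Bool) (z : ℕ → ℕ → ℝ) (r t : ℕ) :
    (innovationsScheme ℓ T h P a d).input b z r t = gain P (d r t) *
      hopError P (d r) (hopIncr P h d (sourceIncr ℓ T a b)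
        ((innovationsScheme ℓ T h P a d).output b z) r)
        ((innovationsScheme ℓ T h P a d).output b z r) t := by
  cases r with
  | zero =>
    rw [Scheme.input, hopError, hopIncr, sum_sourceIncr]
    simp only [innovationsScheme, bitCount, Scheme.output, smul_eq_mul, Finset.sum_range]
  | succ r =>
    rw [Scheme.input, hopError, hopIncr, Hops.sum_incr]
    simp only [innovationsScheme, Scheme.output, smul_eq_mul, Finset.sum_range]

lemma innovationsScheme_output (b : ℕ → Bool) (z : ℕ → ℕ → ℝ) :
    IsCascadeOutput P h d (sourceIncr ℓ T a b) z ((innovationsScheme ℓ T h P a d).output b z) := by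
  intro r t
  rw [Scheme.output, innovationsScheme_input]
  rfl

lemma innovationsScheme_estimate (b : ℕ → Bool) (z : ℕ → ℕ → ℝ) (r n t : ℕ) :
    (innovationsScheme ℓ T h P a d).estimate b z r n t = decide (0 < greedyResidual a
      (∑ s ∈ Finset.range (t + 1),
        mmseCoef P (d r s) • (innovationsScheme ℓ T h P a d).output b z r s) n) := by
  rw [Scheme.estimate, Finset.sum_range]
  rfl

end Scheme

/-! ### Transfer of the hop relations along linear maps -/

section Transfer

variable {V W : Type*} [AddCommGroup V] [Module ℝ V] [AddCommGroup W] [Module ℝ W]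

lemma IsHopOutput.mem {P : ℝ} {d : ℕ → ℝ} {I z y : ℕ → V} (h : IsHopOutput P d I z y)
    (S : Submodule ℝ V) (hI : ∀ t, I t ∈ S) (hz : ∀ t, z t ∈ S) (t : ℕ) : y t ∈ S := by
  induction t using Nat.strong_induction_on with
  | _ t ih =>
    rw [h t]
    refine S.add_mem (S.smul_mem _ (S.sub_mem (S.sum_mem fun s _ => hI s)
      (S.sum_mem fun s hs => S.smul_mem _ (ih s (Finset.mem_range.1 hs))))) (hz t)

lemma IsCascadeOutput.mem {P : ℝ} {h : Hops} {d : ℕ → ℕ → ℝ} {w : ℕ → V} {z y : ℕ → ℕ → V}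
    (hc : IsCascadeOutput P h d w z y) (S : Submodule ℝ V) (hw : ∀ t, w t ∈ S)
    (hz : ∀ r t, z r t ∈ S) (r t : ℕ) : y r t ∈ S := by
  have key (r : ℕ) : ∀ t, hopIncr P h d w y r t ∈ S := by
    induction r with
    | zero => exact hw
    | succ r ih =>
      have hy (t : ℕ) : mmseCoef P (d r t) • y r t ∈ S :=
        S.smul_mem _ ((hc r).mem S ih (hz r) t)
      intro t
      cases h with
      | instantaneous => exact hy t
      | delayed =>
        cases t with
        | zero => exact S.zero_mem
        | succ t => exact hy t
  exact (hc r).mem S (key r) (hz r) t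

lemma map_hopError (f : V →ₗ[ℝ] W) (P : ℝ) (d : ℕ → ℝ) (I y : ℕ → V) (t : ℕ) :
    f (hopError P d I y t) = hopError P d (fun s => f (I s)) (fun s => f (y s)) t := by
  simp [hopError]

lemma map_hopIncr (f : V →ₗ[ℝ] W) (P : ℝ) (h : Hops) (d : ℕ → ℕ → ℝ) (w : ℕ → V)
    (y : ℕ → ℕ → V) (r t : ℕ) :
    f (hopIncr P h d w y r t) = hopIncr P h d (fun s => f (w s)) (fun r s => f (y r s)) r t := by
  cases r with
  | zero => rfl
  | succ r =>
    cases h with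
    | instantaneous => simp [hopIncr, Hops.incr]
    | delayed => cases t <;> simp [hopIncr, Hops.incr]

lemma map_cascade_hopError (f : V →ₗ[ℝ] W) (P : ℝ) (h : Hops) (d : ℕ → ℕ → ℝ) (w : ℕ → V)
    (y : ℕ → ℕ → V) (r t : ℕ) :
    f (hopError P (d r) (hopIncr P h d w y r) (y r) t)
      = hopError P (d r) (hopIncr P h d (fun s => f (w s)) (fun r s => f (y r s)) r)
        (fun s => f (y r s)) t := by
  rw [map_hopError]
  congr 1
  funext s
  exact map_hopIncr f P h d w y r s

/-- Used with evaluation at the sample points `ω`: the relations hold for each realization and are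
lifted to random variables. -/
lemma IsCascadeOutput.of_separating {ι : Type*} (f : ι → V →ₗ[ℝ] W)
    (hf : ∀ u v, (∀ i, f i u = f i v) → u = v)
    {P : ℝ} {h : Hops} {d : ℕ → ℕ → ℝ} {w : ℕ → V} {z y : ℕ → ℕ → V}
    (hc : ∀ i, IsCascadeOutput P h d (fun s => f i (w s)) (fun r s => f i (z r s))
      (fun r s => f i (y r s))) :
    IsCascadeOutput P h d w z y := by
  intro r t
  refine hf _ _ fun i => ?_
  change _ = f i (gain P (d r t) • hopError P (d r) (hopIncr P h d w y r) (y r) t + z r t)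
  rw [map_add, map_smul, map_cascade_hopError]
  exact hc i r t

end Transfer

/-! ### Second moments -/

section SecondMoments

variable {Ω : Type*} [MeasurableSpace Ω] (μ : Measure Ω)

/-- The space of square integrable random variables (not up to equality almost everywhere). -/
def squareIntegrable : Submodule ℝ (Ω → ℝ) where
  carrier := {f | MemLp f 2 μ}
  add_mem' hf hg := MemLp.add hf hg
  zero_mem' := MemLp.zero
  smul_mem' c _ hf := MemLp.const_smul hf c

/-- The second moments of square integrable random variables. -/
noncomputable def secondMoment : LinearMap.BilinForm ℝ (squareIntegrable μ) :=
  LinearMap.mk₂ ℝ (fun f g => ∫ ω, f.1 ω * g.1 ω ∂μ)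
    (fun f f' g => by
      simp only [Submodule.coe_add, Pi.add_apply, add_mul]
      exact integral_add (f.2.integrable_mul g.2) (f'.2.integrable_mul g.2))
    (fun c f g => by
      simp only [Submodule.coe_smul, Pi.smul_apply, smul_eq_mul, mul_assoc]
      exact integral_const_mul _ _)
    (fun f g g' => by
      simp only [Submodule.coe_add, Pi.add_apply, mul_add]
      exact integral_add (f.2.integrable_mul g.2) (f.2.integrable_mul g'.2))
    (fun c f g => by
      simp only [Submodule.coe_smul, Pi.smul_apply, smul_eq_mul, mul_left_comm]
      exact integral_const_mul _ _)

lemma secondMoment_apply (f g : squareIntegrable μ) :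
    secondMoment μ f g = ∫ ω, f.1 ω * g.1 ω ∂μ := rfl

lemma secondMoment_comm (f g : squareIntegrable μ) :
    secondMoment μ f g = secondMoment μ g f := by
  simp only [secondMoment_apply, mul_comm]

lemma secondMoment_self_nonneg (f : squareIntegrable μ) : 0 ≤ secondMoment μ f f :=
  integral_nonneg fun _ => mul_self_nonneg _

lemma lintegral_sq_eq_secondMoment (f : squareIntegrable μ) :
    ∫⁻ ω, ENNReal.ofReal (f.1 ω ^ 2) ∂μ = ENNReal.ofReal (secondMoment μ f f) := by
  have h1 : Integrable (fun ω => f.1 ω * f.1 ω) μ := f.2.integrable_mul f.2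
  rw [secondMoment_apply, ofReal_integral_eq_lintegral_ofReal h1
    (ae_of_all _ fun _ => mul_self_nonneg _)]
  simp only [sq]

lemma measure_le_abs_le_secondMoment (f : squareIntegrable μ) {c : ℝ} (hc : 0 < c) :
    μ {ω | c ≤ |f.1 ω|} ≤ ENNReal.ofReal (secondMoment μ f f / c ^ 2) := by
  have h1 : AEMeasurable (fun ω => ENNReal.ofReal (f.1 ω ^ 2)) μ :=
    (f.2.aestronglyMeasurable.aemeasurable.pow_const 2).ennreal_ofReal
  have h2 := meas_ge_le_lintegral_div h1 (ε := ENNReal.ofReal (c ^ 2))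
    (by simpa using hc.ne') ENNReal.ofReal_ne_top
  rw [lintegral_sq_eq_secondMoment, ← ENNReal.ofReal_div_of_pos (by positivity)] at h2
  refine (measure_mono fun ω hω => ?_).trans h2
  have h3 : c ≤ |f.1 ω| := hω
  refine ENNReal.ofReal_le_ofReal ?_
  rw [← sq_abs (f.1 ω)]
  gcongr

end SecondMoments

/-! ### The cascade with innovations coding under the model -/

namespace IsModel

variable {Ω : Type*} [MeasurableSpace Ω] {μ : Measure Ω}
  {b : ℕ → Ω → Bool} {Z : ℕ → ℕ → Ω → ℝ}

lemma measurable_symbol (hm : IsModel μ b Z) (n : ℕ) : Measurable fun ω => antipodal (b n ω) :=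
  measurable_antipodal.comp (hm.measurable_bit n)

/-- The noise of channel `r` at time `t`. -/
def noise (hm : IsModel μ b Z) (r t : ℕ) : squareIntegrable μ :=
  ⟨Z r t, hm.noise_memLp r t⟩

lemma secondMoment_noise_of_ne (hm : IsModel μ b Z) {r r' t t' : ℕ} (h : (r, t) ≠ (r', t')) :
    secondMoment μ (hm.noise r t) (hm.noise r' t') = 0 := by
  rw [secondMoment_apply]
  have hi : IndepFun (fun ω => Z r t ω) (fun ω => Z r' t' ω) μ := hm.noise_indep.indepFun h
  refine (hi.integral_fun_mul_eq_mul_integral (hm.measurable_noise r t).aestronglyMeasurable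
    (hm.measurable_noise r' t').aestronglyMeasurable).trans ?_
  rw [hm.noise_mean, zero_mul]

lemma secondMoment_noise_self (hm : IsModel μ b Z) (r t : ℕ) :
    secondMoment μ (hm.noise r t) (hm.noise r t) = 1 := by
  rw [secondMoment_apply, ← hm.noise_variance r t,
    variance_of_integral_eq_zero (hm.measurable_noise r t).aemeasurable (hm.noise_mean r t)]
  simp [noise, sq]

variable [IsProbabilityMeasure μ]

lemma memLp_symbol (hm : IsModel μ b Z) (n : ℕ) : MemLp (fun ω => antipodal (b n ω)) 2 μ :=
  MemLp.of_bound (hm.measurable_symbol n).aestronglyMeasurable 1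
    (ae_of_all _ fun _ => (abs_antipodal _).le)

/-- The antipodal symbol of bit `n`. -/
def symbol (hm : IsModel μ b Z) (n : ℕ) : squareIntegrable μ :=
  ⟨fun ω => antipodal (b n ω), hm.memLp_symbol n⟩

lemma integral_symbol (hm : IsModel μ b Z) (n : ℕ) : ∫ ω, antipodal (b n ω) ∂μ = 0 := by
  have hmeas : MeasurableSet {ω | b n ω = true} :=
    hm.measurable_bit n (measurableSet_singleton true)
  have h1 : (fun ω => antipodal (b n ω))
      = fun ω => 2 * {ω | b n ω = true}.indicator (fun _ => (1 : ℝ)) ω - 1 := by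
    funext ω
    by_cases h : b n ω = true
    · simp [antipodal, h]; norm_num
    · simp [antipodal, h]
  rw [h1, integral_sub (((integrable_const _).indicator hmeas).const_mul 2) (integrable_const _),
    integral_const_mul, integral_indicator_const _ hmeas, measureReal_def, hm.bit_uniform n]
  simp

lemma secondMoment_symbol (hm : IsModel μ b Z) (m n : ℕ) :
    secondMoment μ (hm.symbol m) (hm.symbol n) = if m = n then 1 else 0 := by
  rw [secondMoment_apply]
  split_ifs with h
  · subst h
    simp [symbol, antipodal_mul_self]
  · have hi : IndepFun (fun ω => antipodal (b m ω)) (fun ω => antipodal (b n ω)) μ :=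
      (hm.bit_indep.indepFun h).comp measurable_antipodal measurable_antipodal
    refine (hi.integral_fun_mul_eq_mul_integral (hm.measurable_symbol m).aestronglyMeasurable
      (hm.measurable_symbol n).aestronglyMeasurable).trans ?_
    rw [hm.integral_symbol, zero_mul]

lemma secondMoment_symbol_noise (hm : IsModel μ b Z) (n r t : ℕ) :
    secondMoment μ (hm.symbol n) (hm.noise r t) = 0 := by
  rw [secondMoment_apply]
  have hi : IndepFun (fun ω => antipodal (b n ω)) (fun ω => Z r t ω) μ :=
    hm.bit_noise_indep.comp (φ := fun x : ℕ → Bool => antipodal (x n))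
      (ψ := fun x : ℕ × ℕ → ℝ => x (r, t))
      (measurable_antipodal.comp (measurable_pi_apply n)) (measurable_pi_apply _)
  refine (hi.integral_fun_mul_eq_mul_integral (hm.measurable_symbol n).aestronglyMeasurable
    (hm.measurable_noise r t).aestronglyMeasurable).trans ?_
  rw [hm.integral_symbol, zero_mul]

/-- The increment of the source signal at time `t`. -/
noncomputable def signalIncr (hm : IsModel μ b Z) (ℓ T : ℕ) (a : ℝ) (t : ℕ) : squareIntegrable μ :=
  ∑ n ∈ Finset.Ico (bitCount ℓ T t) (bitCount ℓ T (t + 1)), a ^ n • hm.symbol n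

lemma signalIncr_apply (hm : IsModel μ b Z) (ℓ T : ℕ) (a : ℝ) (t : ℕ) (ω : Ω) :
    (hm.signalIncr ℓ T a t).1 ω = sourceIncr ℓ T a (fun n => b n ω) t := by
  simp [signalIncr, sourceIncr, symbol, Finset.sum_apply]

lemma secondMoment_signalIncr (hm : IsModel μ b Z) (ℓ T : ℕ) (a : ℝ) (s t : ℕ) :
    secondMoment μ (hm.signalIncr ℓ T a s) (hm.signalIncr ℓ T a t)
      = if s = t then sourceEnergy ℓ T a t else 0 := by
  simp only [signalIncr, map_sum, LinearMap.sum_apply, map_smul, LinearMap.smul_apply,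
    hm.secondMoment_symbol, smul_eq_mul]
  split_ifs with h
  · subst h
    rw [sourceEnergy]
    refine Finset.sum_congr rfl fun n hn => ?_
    simp only [mul_ite, mul_one, mul_zero, Finset.sum_ite_eq', hn, if_true]
    ring
  · refine Finset.sum_eq_zero fun n hn => mul_eq_zero_of_right _ ?_
    refine Finset.sum_eq_zero fun m hm' => ?_
    -- Different times carry disjoint blocks of bits.
    have hne : m ≠ n := by
      rintro rfl
      rw [Finset.mem_Ico] at hn hm'
      have hmono := bitCount_mono ℓ T
      rcases Nat.lt_or_gt_of_ne h with h | h
      · have := hmono (show s + 1 ≤ t by omega)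
        omega
      · have := hmono (show t + 1 ≤ s by omega)
        omega
    simp [hne]

/-- The channel outputs under innovations coding. -/
noncomputable def output (hm : IsModel μ b Z) (ℓ T : ℕ) (h : Hops) (P a : ℝ) (d : ℕ → ℕ → ℝ)
    (r t : ℕ) : squareIntegrable μ :=
  ⟨fun ω => (innovationsScheme ℓ T h P a d).output (fun n => b n ω) (fun r t => Z r t ω) r t, by
    -- The relations are first obtained among plain functions on `Ω`; square integrability then
    -- follows from closure under linear combinations.
    have hc : IsCascadeOutput P h d (fun t => (hm.signalIncr ℓ T a t).1) Z (fun r t ω =>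
        (innovationsScheme ℓ T h P a d).output (fun n => b n ω) (fun r t => Z r t ω) r t) := by
      refine IsCascadeOutput.of_separating (fun ω : Ω => LinearMap.proj (R := ℝ) ω)
        (fun u v huv => funext huv) fun ω => ?_
      simp only [LinearMap.proj_apply, signalIncr_apply]
      exact innovationsScheme_output _ _
    exact hc.mem (squareIntegrable μ) (fun t => (hm.signalIncr ℓ T a t).2) hm.noise_memLp r t⟩

lemma isWhiteCascade (hm : IsModel μ b Z) (ℓ T : ℕ) (h : Hops) {P : ℝ} (hP : 0 < P) (a : ℝ) :
    IsWhiteCascade (secondMoment μ) P h (sourceEnergy ℓ T a) (hm.signalIncr ℓ T a) hm.noise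
      (hm.output ℓ T h P a (hopEnergy P h (sourceEnergy ℓ T a))) where
  output := by
    refine IsCascadeOutput.of_separating
      (fun ω : Ω => (LinearMap.proj (R := ℝ) ω).comp (squareIntegrable μ).subtype)
      (fun u v huv => Subtype.ext (funext huv)) fun ω => ?_
    simp only [LinearMap.comp_apply, Submodule.subtype_apply, LinearMap.proj_apply,
      signalIncr_apply]
    exact innovationsScheme_output _ _
  symm := secondMoment_comm μ
  pos := hP
  energy t := by rw [hm.secondMoment_signalIncr, if_pos rfl]
  nonneg := sourceEnergy_nonneg ℓ T a
  source_white s t hst := by rw [hm.secondMoment_signalIncr, if_neg hst]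
  source_noise s r t := by
    simp [signalIncr, map_sum, LinearMap.sum_apply, hm.secondMoment_symbol_noise]
  noise r s t := by
    split_ifs with hst
    · rw [hst, hm.secondMoment_noise_self]
    · exact hm.secondMoment_noise_of_ne (by simpa using hst)
  noise_white r r' s t hr := hm.secondMoment_noise_of_ne (by simp [hr])

lemma powerConstraint (hm : IsModel μ b Z) (ℓ T : ℕ) (h : Hops) {P : ℝ} (hP : 0 < P) (a : ℝ) :
    (innovationsScheme ℓ T h P a (hopEnergy P h (sourceEnergy ℓ T a))).PowerConstraint μ b Z P := by
  intro r t
  set d := hopEnergy P h (sourceEnergy ℓ T a) with hd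
  have hd0 : 0 ≤ d r t := hopEnergy_nonneg hP h (sourceEnergy_nonneg ℓ T a) r t
  set X : squareIntegrable μ := gain P (d r t) • hopError P (d r)
    (hopIncr P h d (hm.signalIncr ℓ T a) (hm.output ℓ T h P a d) r)
    (hm.output ℓ T h P a d r) t with hX
  have hin (ω : Ω) : (innovationsScheme ℓ T h P a d).input (fun i => b i ω)
      (fun r t => Z r t ω) r t = X.1 ω := by
    change _ = ((LinearMap.proj (R := ℝ) ω).comp (squareIntegrable μ).subtype) X
    rw [innovationsScheme_input, hX, map_smul, map_cascade_hopError]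
    simp only [LinearMap.comp_apply, Submodule.subtype_apply, LinearMap.proj_apply,
      signalIncr_apply]
    rfl
  simp only [hin]
  rw [lintegral_sq_eq_secondMoment]
  refine ENNReal.ofReal_le_ofReal ?_
  rw [hX, map_smul, map_smul, LinearMap.smul_apply,
    ((hm.isWhiteCascade ℓ T h hP a).isWhiteHop r).energy_hopError t, smul_eq_mul, smul_eq_mul,
    ← mul_assoc, ← sq]
  exact gain_sq_mul_le hP hd0

lemma bitError_le (hm : IsModel μ b Z) {ℓ T : ℕ} {h : Hops} {P : ℝ} (hP : 0 < P) {a : ℝ}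
    (ha0 : 0 < a) (ha : a < 1 / 2) {r n t : ℕ} (hn : n < (t / T + 1) * ℓ) {M : ℝ}
    (hM : ∀ j ≤ r, hopEnergy P h (sourceEnergy ℓ T a) j t ≤ M) :
    (innovationsScheme ℓ T h P a (hopEnergy P h (sourceEnergy ℓ T a))).bitError μ b Z r n t
      ≤ ENNReal.ofReal ((2 * r + 1) ^ 2 * M / (a ^ n * ((1 - 2 * a) / (1 - a))) ^ 2) := by
  set d := hopEnergy P h (sourceEnergy ℓ T a) with hd
  have hc : 0 < a ^ n * ((1 - 2 * a) / (1 - a)) :=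
    mul_pos (by positivity) (div_pos (by linarith) (by linarith))
  set E : squareIntegrable μ := ∑ s ∈ Finset.range (t + 1), hm.signalIncr ℓ T a s
    - ∑ s ∈ Finset.range (t + 1), mmseCoef P (d r s) • hm.output ℓ T h P a d r s with hE
  have hEn : secondMoment μ E E ≤ (2 * r + 1) ^ 2 * M :=
    (hm.isWhiteCascade ℓ T h hP a).energy_error_le (secondMoment_self_nonneg μ) r t hM
  calc (innovationsScheme ℓ T h P a d).bitError μ b Z r n t
      ≤ μ {ω | a ^ n * ((1 - 2 * a) / (1 - a)) ≤ |E.1 ω|} := by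
        refine measure_mono fun ω hω => ?_
        by_contra hlt
        refine hω ?_
        rw [innovationsScheme_estimate]
        refine greedy_decode ha0 ha (fun i => b i ω) hn ?_
        have h1 : E.1 ω = ∑ m ∈ Finset.range ((t / T + 1) * ℓ), a ^ m * antipodal (b m ω)
            - ∑ s ∈ Finset.range (t + 1), mmseCoef P (d r s) •
              (innovationsScheme ℓ T h P a d).output (fun i => b i ω)
                (fun r t => Z r t ω) r s := by
          have h2 := sum_sourceIncr ℓ T a (fun i => b i ω) (t + 1)
          rw [bitCount] at h2
          rw [← h2]
          change ((LinearMap.proj (R := ℝ) ω).comp (squareIntegrable μ).subtype) E = _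
          rw [hE, map_sub, map_sum, map_sum]
          simp only [map_smul, LinearMap.comp_apply, Submodule.subtype_apply,
            LinearMap.proj_apply, signalIncr_apply]
          rfl
        rw [abs_sub_comm, ← h1]
        exact not_le.1 hlt
    _ ≤ ENNReal.ofReal (secondMoment μ E E / (a ^ n * ((1 - 2 * a) / (1 - a))) ^ 2) :=
        measure_le_abs_le_secondMoment μ E hc
    _ ≤ _ := by gcongr

end IsModel

/-! ### Achievable velocities -/

lemma avgRate_pos {ℓ T : ℕ} (hℓ : 0 < ℓ) (hT : 0 < T) : 0 < avgRate ℓ T := by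
  have := Real.log_pos one_lt_two
  unfold avgRate
  positivity

lemma exp_two_mul_capacity {P : ℝ} (hP : 0 < P) : Real.exp (2 * capacity P) = 1 + P := by
  rw [capacity, show 2 * (1 / 2 * Real.log (1 + P)) = Real.log (1 + P) by ring,
    Real.exp_log (by linarith)]

lemma one_div_one_add_lt_exp {P ρ : ℝ} (hP : 0 < P) (hρ : ρ < capacity P) :
    1 / (1 + P) < Real.exp (-2 * ρ) := by
  rw [← exp_two_mul_capacity hP, one_div, ← Real.exp_neg]
  exact Real.exp_lt_exp.2 (by linarith)

/-- Here the source rate enters: excess rate is what makes greedy decoding possible. -/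
lemma exp_neg_mul_div_lt_half {ℓ T : ℕ} (hℓ : 0 < ℓ) (hT : 0 < T) {ρ : ℝ} (hρ : avgRate ℓ T < ρ) :
    Real.exp (-ρ * T / ℓ) < 1 / 2 := by
  have hℓ' : (0 : ℝ) < ℓ := by exact_mod_cast hℓ
  have hT' : (0 : ℝ) < T := by exact_mod_cast hT
  have h1 : (1 : ℝ) / 2 = Real.exp (-Real.log 2) := by
    rw [Real.exp_neg, Real.exp_log two_pos, one_div]
  rw [h1, Real.exp_lt_exp, div_lt_iff₀ hℓ']
  have h2 : ℓ / T * Real.log 2 * T < ρ * T := mul_lt_mul_of_pos_right hρ hT'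
  have h3 : (ℓ : ℝ) / T * Real.log 2 * T = Real.log 2 * ℓ := by field_simp
  linarith

lemma tendsto_two_mul_add_one_sq_mul_pow {x : ℝ} (hx0 : 0 ≤ x) (hx : x < 1) (c : ℝ) :
    Tendsto (fun r : ℕ => c * ((2 * (r : ℝ) + 1) ^ 2 * x ^ r)) atTop (𝓝 0) := by
  have hx' : |x| < 1 := by rwa [abs_of_nonneg hx0]
  have h (k : ℕ) := tendsto_pow_const_mul_const_pow_of_abs_lt_one k hx'
  have h1 := ((((h 2).const_mul 4).add ((h 1).const_mul 4)).add (h 0)).const_mul c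
  simp only [mul_zero, add_zero] at h1
  refine h1.congr fun r => ?_
  ring

section Achievability

variable {Ω : Type*} [MeasurableSpace Ω] {μ : Measure Ω} [IsProbabilityMeasure μ]
  {b : ℕ → Ω → Bool} {Z : ℕ → ℕ → Ω → ℝ}

lemma maxBitError_le (hm : IsModel μ b Z) {P : ℝ} (hP : 0 < P) {ℓ T : ℕ} (hℓ : 0 < ℓ)
    (hT : 0 < T) (h : Hops) {ρ : ℝ} (hρ : avgRate ℓ T < ρ) (hρC : ρ < capacity P) (r Δ : ℕ) :
    (innovationsScheme ℓ T h P (Real.exp (-ρ * T / ℓ))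
      (hopEnergy P h (sourceEnergy ℓ T (Real.exp (-ρ * T / ℓ))))).maxBitError μ b Z r Δ
      ≤ ENNReal.ofReal ((2 * r + 1) ^ 2 * (ℓ * h.growth P (Real.exp (-2 * ρ)) ^ r
        / (1 - 1 / (1 + P) / Real.exp (-2 * ρ)) * Real.exp (-2 * ρ) ^ Δ)
        / (Real.exp (-2 * ρ) ^ T * ((1 - 2 * Real.exp (-ρ * T / ℓ))
          / (1 - Real.exp (-ρ * T / ℓ))) ^ 2)) := by
  have hρ0 : 0 < ρ := (avgRate_pos hℓ hT).trans hρ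
  have hg := one_div_one_add_lt_exp hP hρC
  have ha := exp_neg_mul_div_lt_half hℓ hT hρ
  have he := sourceEnergy_le hℓ hT hρ0.le
  have hg1 : Real.exp (-2 * ρ) ≤ 1 := Real.exp_le_one_iff.2 (by linarith)
  have hg0 := Real.exp_pos (-2 * ρ)
  have ha0 := Real.exp_pos (-ρ * T / ℓ)
  have hag : Real.exp (-ρ * T / ℓ) ^ (2 * ℓ) = Real.exp (-2 * ρ) ^ T := by
    rw [← Real.exp_nat_mul, ← Real.exp_nat_mul]
    congr 1
    have hℓ' : (ℓ : ℝ) ≠ 0 := by exact_mod_cast hℓ.ne'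
    push_cast
    field_simp
  generalize Real.exp (-ρ * T / ℓ) = a at *
  generalize Real.exp (-2 * ρ) = g at *
  have hG := h.one_le_growth hP hg hg1
  have hc : 0 < 1 - 1 / (1 + P) / g := by rw [sub_pos, div_lt_one hg0]; exact hg
  have hκ : 0 < (1 - 2 * a) / (1 - a) := div_pos (by linarith) (by linarith)
  refine iSup_le fun τ => iSup₂_le fun n hn => ?_
  have hn2 := (Finset.mem_Ico.1 hn).2
  have hM (j : ℕ) (hj : j ≤ r) : hopEnergy P h (sourceEnergy ℓ T a) j (τ * T + Δ)
      ≤ ℓ * h.growth P g ^ r / (1 - 1 / (1 + P) / g) * g ^ (τ * T + Δ) := by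
    refine (hopEnergy_le hP h (Nat.cast_nonneg ℓ) hg he j _).trans ?_
    gcongr
  have hn3 : n < ((τ * T + Δ) / T + 1) * ℓ := by
    refine hn2.trans_le ?_
    gcongr
    rw [Nat.le_div_iff_mul_le hT]
    omega
  refine (hm.bitError_le hP ha0 ha hn3 hM).trans (ENNReal.ofReal_le_ofReal ?_)
  generalize (1 - 2 * a) / (1 - a) = κ at hκ ⊢
  -- From `n < (τ + 1) ℓ` and `a ^ (2 ℓ) = g ^ T`. The factor `g ^ (τ T)` cancels against the error
  -- energy, making the bound uniform in `τ`.
  have han : g ^ (τ * T) * g ^ T ≤ (a ^ n) ^ 2 := by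
    rw [← pow_add, ← pow_mul, show τ * T + T = T * (τ + 1) by ring, pow_mul, ← hag, ← pow_mul]
    refine pow_le_pow_of_le_one ha0.le (by linarith) ?_
    rw [mul_assoc, mul_comm n, mul_comm ℓ]
    omega
  have hA : 0 ≤ ℓ * h.growth P g ^ r / (1 - 1 / (1 + P) / g) := by positivity
  generalize ℓ * h.growth P g ^ r / (1 - 1 / (1 + P) / g) = A at hA
  calc (2 * (r : ℝ) + 1) ^ 2 * (A * g ^ (τ * T + Δ)) / (a ^ n * κ) ^ 2
      ≤ (2 * (r : ℝ) + 1) ^ 2 * (A * g ^ (τ * T + Δ)) / (g ^ (τ * T) * g ^ T * κ ^ 2) := by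
        rw [mul_pow]
        gcongr
    _ = (2 * (r : ℝ) + 1) ^ 2 * (A * g ^ Δ) / (g ^ T * κ ^ 2) := by
        rw [pow_add]
        field_simp

lemma achievable_of_mul_log_growth_lt (hm : IsModel μ b Z) {P : ℝ} (hP : 0 < P) {ℓ T : ℕ}
    (hℓ : 0 < ℓ) (hT : 0 < T) (h : Hops) {ρ v : ℝ} (hρ : avgRate ℓ T < ρ) (hρC : ρ < capacity P)
    (hv : 0 < v) (hgrowth : v * Real.log (h.growth P (Real.exp (-2 * ρ))) < 2 * ρ) :
    Achievable μ b Z P ℓ T h v := by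
  have hρ0 : 0 < ρ := (avgRate_pos hℓ hT).trans hρ
  have hg := one_div_one_add_lt_exp hP hρC
  have ha := exp_neg_mul_div_lt_half hℓ hT hρ
  have hG := h.growth_pos hP hg
  have hc : 0 < 1 - 1 / (1 + P) / Real.exp (-2 * ρ) := by
    rw [sub_pos, div_lt_one (Real.exp_pos _)]; exact hg
  refine ⟨_, hm.powerConstraint ℓ T h hP (Real.exp (-ρ * T / ℓ)), ?_⟩
  set G := h.growth P (Real.exp (-2 * ρ)) with hGdef
  set c := 1 - 1 / (1 + P) / Real.exp (-2 * ρ) with hcdef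
  set κ := (1 - 2 * Real.exp (-ρ * T / ℓ)) / (1 - Real.exp (-ρ * T / ℓ)) with hκdef
  have hκ : 0 < κ := div_pos (by linarith) (by linarith)
  -- The decay ratio per hop; `x < 1` is the hypothesis `hgrowth`.
  set x := G * Real.exp (-2 * ρ / v) with hx
  have hx1 : x < 1 := by
    rw [hx, ← Real.exp_log hG, ← Real.exp_add, Real.exp_lt_one_iff, neg_mul, neg_div,
      ← sub_eq_add_neg, sub_neg, lt_div_iff₀ hv]
    linarith
  have hx0 : 0 ≤ x := by positivity
  have hlim := ENNReal.tendsto_ofReal (tendsto_two_mul_add_one_sq_mul_pow hx0 hx1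
    (ℓ / c * Real.exp (2 * ρ) / (Real.exp (-2 * ρ) ^ T * κ ^ 2)))
  rw [ENNReal.ofReal_zero] at hlim
  refine tendsto_of_tendsto_of_tendsto_of_le_of_le tendsto_const_nhds hlim
    (fun _ => zero_le) fun r => ?_
  refine (maxBitError_le hm hP hℓ hT h hρ hρC r _).trans (ENNReal.ofReal_le_ofReal ?_)
  -- Rounding the delay down loses less than one time step, hence the factor `exp (2 ρ)`.
  have hΔ : Real.exp (-2 * ρ) ^ ⌊((r + 1 : ℕ) : ℝ) / v⌋₊
      ≤ Real.exp (2 * ρ) * Real.exp (-2 * ρ / v) ^ r := by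
    rw [← Real.exp_nat_mul, ← Real.exp_nat_mul, ← Real.exp_add, Real.exp_le_exp]
    have h1 := Nat.lt_floor_add_one (((r + 1 : ℕ) : ℝ) / v)
    have h2 : (r : ℝ) / v ≤ ((r + 1 : ℕ) : ℝ) / v := by
      gcongr
      linarith
    have h3 : (r : ℝ) * (-2 * ρ / v) = -2 * ρ * (r / v) := by ring
    rw [h3]
    nlinarith
  calc (2 * (r : ℝ) + 1) ^ 2 * (ℓ * G ^ r / c * Real.exp (-2 * ρ) ^ ⌊((r + 1 : ℕ) : ℝ) / v⌋₊)
        / (Real.exp (-2 * ρ) ^ T * κ ^ 2)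
      ≤ (2 * (r : ℝ) + 1) ^ 2 * (ℓ * G ^ r / c * (Real.exp (2 * ρ) * Real.exp (-2 * ρ / v) ^ r))
        / (Real.exp (-2 * ρ) ^ T * κ ^ 2) := by gcongr
    _ = _ := by
        rw [hx, mul_pow]
        ring

/-- A velocity that satisfies the strict condition at the rate of the source itself is achievable,
as the condition persists for slightly larger rates. -/
lemma achievable_of_avgRate_lt_capacity (hm : IsModel μ b Z) {P : ℝ} (hP : 0 < P) {ℓ T : ℕ}
    (hℓ : 0 < ℓ) (hT : 0 < T) (h : Hops) (hRC : avgRate ℓ T < capacity P) {v : ℝ} (hv : 0 < v)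
    (hgrowth : v * Real.log (h.growth P (Real.exp (-2 * avgRate ℓ T))) < 2 * avgRate ℓ T) :
    Achievable μ b Z P ℓ T h v := by
  have hg := one_div_one_add_lt_exp hP hRC
  have hc : 1 - 1 / (1 + P) / Real.exp (-2 * avgRate ℓ T) ≠ 0 := by
    rw [sub_ne_zero, ne_comm]
    exact ((div_lt_one (Real.exp_pos _)).2 hg).ne
  have hcont : ContinuousAt (fun ρ => h.growth P (Real.exp (-2 * ρ))) (avgRate ℓ T) := by
    cases h <;> simp only [Hops.growth] <;>
      fun_prop (disch := first | exact hc | exact (Real.exp_pos _).ne')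
  have hcont' : ContinuousAt (fun ρ => v * Real.log (h.growth P (Real.exp (-2 * ρ))) - 2 * ρ)
      (avgRate ℓ T) :=
    (continuousAt_const.mul (hcont.log (h.growth_pos hP hg).ne')).sub (by fun_prop)
  have hev := hcont'.eventually_lt_const (sub_neg.2 hgrowth)
  -- The rate is approached from the right, since `a < 1 / 2` needs `ρ > R` strictly.
  obtain ⟨ρ, ⟨hρ, hρC⟩, hR⟩ := (((hev.and (eventually_lt_nhds hRC)).filter_mono
    nhdsWithin_le_nhds).and (self_mem_nhdsWithin (s := Set.Ioi (avgRate ℓ T)))).exists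
  exact achievable_of_mul_log_growth_lt hm hP hℓ hT h hR hρC hv (sub_neg.1 hρ)

end Achievability

/-! ### The velocity condition at the source rate -/

section Velocity

variable {P R : ℝ}

lemma eta_eq_exp (hP : 0 < P) : eta P R = Real.exp (-2 * (capacity P - R)) := by
  rw [show -2 * (capacity P - R) = 2 * R - 2 * capacity P by ring, Real.exp_sub,
    exp_two_mul_capacity hP, eta]
  field_simp
  ring

lemma one_div_div_exp_eq_eta (hP : 0 < P) : 1 / (1 + P) / Real.exp (-2 * R) = eta P R := by
  rw [neg_mul, Real.exp_neg, div_inv_eq_mul, eta]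
  field_simp
  ring

/-- By `log x ≤ x - 1` the left side is at most `η (1 - exp (-2 R))`; strictness comes from `R ≠ 0`
and makes the end velocity itself achievable. -/
lemma eta_mul_log_le (hP : 0 < P) (hη : eta P R < 1) (hR : R ≠ 0) :
    (1 - eta P R) * Real.log (P / (1 + P) / (1 - eta P R)) < 2 * R * eta P R := by
  have h0 : 0 < 1 - eta P R := by linarith
  have h1 := Real.log_le_sub_one_of_pos (show 0 < P / (1 + P) / (1 - eta P R) by positivity)
  have hη0 : 0 < eta P R := by rw [eta_eq_exp hP]; positivity
  have h2 : eta P R * Real.exp (-2 * R) = 1 - P / (1 + P) := by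
    rw [eta, mul_assoc, ← Real.exp_add, show 2 * R + -2 * R = 0 by ring, Real.exp_zero, mul_one]
  have h3 := Real.add_one_lt_exp (show -2 * R ≠ 0 by simpa using hR)
  calc (1 - eta P R) * Real.log (P / (1 + P) / (1 - eta P R))
      ≤ (1 - eta P R) * (P / (1 + P) / (1 - eta P R) - 1) := by gcongr
    _ = P / (1 + P) - (1 - eta P R) := by field_simp
    _ = eta P R - eta P R * Real.exp (-2 * R) := by rw [h2]; ring
    _ < 2 * R * eta P R := by nlinarith

/-- The velocity of innovations coding. -/
noncomputable def Hops.velocity (η : ℝ) : Hops → ℝ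
  | .instantaneous => (1 - η) / η
  | .delayed => 1 - η

lemma velocity_mul_log_growth_lt (h : Hops) (hP : 0 < P) (hη : eta P R < 1) (hR : R ≠ 0) :
    h.velocity (eta P R) * Real.log (h.growth P (Real.exp (-2 * R))) < 2 * R := by
  have h0 : 0 < 1 - eta P R := by linarith
  have hη0 : 0 < eta P R := by rw [eta_eq_exp hP]; positivity
  have key := eta_mul_log_le hP hη hR
  cases h with
  | instantaneous =>
    rw [Hops.velocity, Hops.growth, one_div_div_exp_eq_eta hP, div_mul_eq_mul_div,
      div_lt_iff₀ hη0]
    exact key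
  | delayed =>
    -- The factor `1 / g` adds `2 R` to the logarithm, and `2 R η + (1 - η) 2 R = 2 R`.
    rw [Hops.velocity, Hops.growth, one_div_div_exp_eq_eta hP,
      Real.log_div (by positivity) (Real.exp_pos _).ne', Real.log_exp]
    linarith

end Velocity

/-- Innovations coding achieves its velocity at all rates below the capacity. -/
lemma achievable_velocity {Ω : Type*} [MeasurableSpace Ω] {μ : Measure Ω} [IsProbabilityMeasure μ]
    {b : ℕ → Ω → Bool} {Z : ℕ → ℕ → Ω → ℝ} (hm : IsModel μ b Z) {P : ℝ} (hP : 0 < P) {ℓ T : ℕ}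
    (hℓ : 0 < ℓ) (hT : 0 < T) (h : Hops) (hRC : avgRate ℓ T < capacity P) :
    0 < h.velocity (eta P (avgRate ℓ T)) ∧
      Achievable μ b Z P ℓ T h (h.velocity (eta P (avgRate ℓ T))) := by
  have hη0 : 0 < eta P (avgRate ℓ T) := by rw [eta_eq_exp hP]; positivity
  have hη : eta P (avgRate ℓ T) < 1 := by
    rw [eta_eq_exp hP, Real.exp_lt_one_iff]; linarith
  have hv : 0 < h.velocity (eta P (avgRate ℓ T)) := by
    have : 0 < 1 - eta P (avgRate ℓ T) := by linarith
    cases h <;> unfold Hops.velocity <;> positivity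
  exact ⟨hv, achievable_of_avgRate_lt_capacity hm hP hℓ hT h hRC hv
    (velocity_mul_log_growth_lt h hP hη (avgRate_pos hℓ hT).ne')⟩

end CascadeIV

theorem theorem5 {Ω : Type*} [MeasurableSpace Ω] (μ : MeasureTheory.Measure Ω)
    [MeasureTheory.IsProbabilityMeasure μ] (b : ℕ → Ω → Bool) (Z : ℕ → ℕ → Ω → ℝ)
    (hmodel : CascadeIV.IsModel μ b Z) (P : ℝ) (hP : 0 < P) (ℓ T : ℕ) (hℓ : 0 < ℓ) (hT : 0 < T)
    (R C η : ℝ) (hR : R = CascadeIV.avgRate ℓ T) (hC : C = CascadeIV.capacity P)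
    (hη : η = CascadeIV.eta P R) (hRC : R < C) :
    (ENNReal.ofReal (Real.exp (2 * (C - R)) - 1)
        ≤ CascadeIV.streamingIV μ b Z P ℓ T CascadeIV.Hops.instantaneous ∧
      Real.exp (2 * (C - R)) - 1 = (1 - η) / η) ∧
    (ENNReal.ofReal (1 - Real.exp (-2 * (C - R)))
        ≤ CascadeIV.streamingIV μ b Z P ℓ T CascadeIV.Hops.delayed ∧
      1 - Real.exp (-2 * (C - R)) = 1 - η) ∧
    (∀ h : CascadeIV.Hops, ∃ v : ℝ, 0 < v ∧ CascadeIV.Achievable μ b Z P ℓ T h v) := by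
  subst hR hC
  have hη' : η = Real.exp (-2 * (CascadeIV.capacity P - CascadeIV.avgRate ℓ T)) := by
    rw [hη, CascadeIV.eta_eq_exp hP]
  have key (h : CascadeIV.Hops) : 0 < h.velocity η ∧
      CascadeIV.Achievable μ b Z P ℓ T h (h.velocity η) := by
    rw [hη]
    exact CascadeIV.achievable_velocity hmodel hP hℓ hT h hRC
  have hle (h : CascadeIV.Hops) :
      ENNReal.ofReal (h.velocity η) ≤ CascadeIV.streamingIV μ b Z P ℓ T h :=
    le_iSup₂_of_le (h.velocity η) (key h) le_rfl
  have h1 : Real.exp (2 * (CascadeIV.capacity P - CascadeIV.avgRate ℓ T)) - 1 = (1 - η) / η := by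
    rw [hη', neg_mul, Real.exp_neg]
    field_simp
  rw [← hη', h1]
  exact ⟨⟨hle .instantaneous, rfl⟩, ⟨hle .delayed, rfl⟩, fun h => ⟨_, key h⟩⟩
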